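/- Let $n\ge 0$ and let $k_1,\dots,k_n\in\{-1,0,1\}$. Put $K_m=k_1\cdots k_m$ ($K_0=1$) and $x\odot y=\sum_{i=0}^n K_i x_i y_i$ on $\mathbb R^{n+1}$. Let $\Sigma=\{x\in\mathbb R^{n+1}: x\odot x=1\}$ and let $\mathbb B^n\subset\mathbb{RP}^n$ be the set of points that have a representative in $\Sigma$ (so $\mathbb B^n=\Sigma/\{\pm1\}$). Let $$C(x,k)=\sum_{m\ge0}(-k)^m\frac{x^{2m}}{(2m)!},\qquad S(x,k)=\sum_{m\ge0}(-k)^m\frac{x^{2m+1}}{(2m+1)!}\qquad(0^0=1).$$ The main rotation $\mathfrak R_m(\varphi)$, $1\le m\le n$, is the linear map of $\mathbb R^{n+1}$ that acts on the coordinates $(x_{m-1},x_m)$ by the matrix $\begin{pmatrix}C(\varphi,k_m)&-k_mS(\varphi,k_m)\\ S(\varphi,k_m)&C(\varphi,k_m)\end{pmatrix}$ and fixes the other coordinates. A motion is a finite product of main rotations and of coordinate reflections $\mathrm{diag}(\pm1,\dots,\pm1)$; without reflections it is proper. Intrinsic volume. For vectors $v_1,\dots,v_n$ tangent to $\Sigma$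 at a point, the intrinsic $n$-volume of their parallelepiped is $\sqrt{\det\big((v_i\odot v_j)/K_i\big)_{i,j=1}^n}$, where, if some characteristics are zero, these are replaced by $\varepsilon\neq0$ and the limit $\varepsilon\to0$ is taken. A patch is an injective $C^1$ map $p:U\to\Sigma$, $U\subset\mathbb R^n$ open, with a measurable set $A\subset U$; it covers $p(A)$, and its volume is the integral over $A$ of the intrinsic $n$-volume of the parallelepiped on $\partial_1p,\dots,\partial_np$. The intrinsic volume $V_{\mathbb B}(F)\in[0,\infty]$ of $F\subset\Sigma$ is the infimum of the total volumes of countable families of patches that cover $F$; for $F\subset\mathbb B^n$ it is defined in the same way, where a point is covered if one of its representatives is. For $F\subset\Sigma$ let $\mathrm{cone}(F)=\{tx: 0\le t\le1,\ x\in F\}$, and let $V_{\mathbb R}$ be the Lebesgue (outer) measure on $\mathbb R^{n+1}$. (1) Let $n=1$, $k=k_1$ and $\alpha\le\beta$, with $\beta-\alpha\le2\pi$ if $k=1$. The sector $\mathrm{cone}(\{(C(\varphi,k),S(\varphi,k)):\alpha\le\varphi\le\beta\})$ has Euclidean area $(\beta-\alpha)/2$, and its arc has intrinsic volume (length) $\beta-\alpha$.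 (2) For every $F\subset\Sigma$, $V_{\mathbb B}(F)=(n+1)\,V_{\mathbb R}(\mathrm{cone}(F))$. Moreover, if $F\subset\mathbb B^n$ and $G\subset\Sigma$ contains exactly one representative of each point of $F$ and no other vectors, and $\mathrm{cone}(G)$ is Lebesgue measurable, then $V_{\mathbb B}(F)=(n+1)\,V_{\mathbb R}(\mathrm{cone}(G))$. (3) Every motion $M$ satisfies $|\det M|=1$, maps $\Sigma$ onto $\Sigma$ and $\mathbb B^n$ onto $\mathbb B^n$, and preserves volume: $V_{\mathbb R}(\mathrm{cone}(MF))=V_{\mathbb R}(\mathrm{cone}(F))$ and $V_{\mathbb B}(MF)=V_{\mathbb B}(F)$ for all $F\subset\Sigma$, and $V_{\mathbb B}(MF)=V_{\mathbb B}(F)$ for all $F\subset\mathbb B^n$. -/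

import Mathlib

open MeasureTheory Set Filter Topology
open scoped ENNReal LinearAlgebra.Projectivization

noncomputable section

namespace GeomSpace

/-- The generalized cosine `C(x, k)`; here `0 ^ 0 = 1`. It is `cos x`, `1`, `cosh x` for
`k = 1`, `0`, `-1`. -/
def C (k x : ℝ) : ℝ := ∑' m : ℕ, (-k) ^ m * x ^ (2 * m) / (Nat.factorial (2 * m) : ℝ)

/-- The generalized sine `S(x, k)`. It is `sin x`, `x`, `sinh x` for `k = 1`, `0`, `-1`. -/
def S (k x : ℝ) : ℝ := ∑' m : ℕ, (-k) ^ m * x ^ (2 * m + 1) / (Nat.factorial (2 * m + 1) : ℝ)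

/-- A specification: every characteristic `k_1, …, k_n` is `-1`, `0` or `1`
(`k i` is the characteristic usually called `k_{i+1}`). -/
def IsSpecification {n : ℕ} (k : Fin n → ℝ) : Prop :=
  ∀ i, k i = -1 ∨ k i = 0 ∨ k i = 1

/-- `K_m = k_1 k_2 ⋯ k_m`, for `m = 0, …, n`. -/
def K {n : ℕ} (k : Fin n → ℝ) (m : Fin (n + 1)) : ℝ :=
  ∏ i ∈ Finset.univ.filter (fun i : Fin n => (i : ℕ) < (m : ℕ)), k i

/-- The product `x ⊙ y = ∑ K_i x_i y_i` on `ℝ^{n+1}`. -/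
def odot {n : ℕ} (k : Fin n → ℝ) (x y : Fin (n + 1) → ℝ) : ℝ :=
  ∑ i, K k i * x i * y i

/-- The space seen as the unit sphere `x ⊙ x = 1` of `ℝ^{n+1}` (normalized coordinate vectors). -/
def sphere {n : ℕ} (k : Fin n → ℝ) : Set (Fin (n + 1) → ℝ) :=
  {x | odot k x x = 1}

/-- The space `𝔹^n` itself: the points of `ℝP^n` that have a normalized coordinate vector. -/
def space {n : ℕ} (k : Fin n → ℝ) : Set (ℙ ℝ (Fin (n + 1) → ℝ)) :=
  {p | ∃ x ∈ p.submodule, x ∈ sphere k}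

/-! ### Motions -/

/-- The main rotation `ℜ_{m+1}(φ)`: it acts in the plane of the coordinates `m`, `m + 1`. -/
def mainRotation {n : ℕ} (k : Fin n → ℝ) (m : Fin n) (φ : ℝ) :
    Matrix (Fin (n + 1)) (Fin (n + 1)) ℝ :=
  Matrix.of fun i j =>
    if i = m.castSucc ∧ j = m.castSucc then C (k m) φ
    else if i = m.castSucc ∧ j = m.succ then -(k m) * S (k m) φ
    else if i = m.succ ∧ j = m.castSucc then S (k m) φ
    else if i = m.succ ∧ j = m.succ then C (k m) φ
    else if i = j then 1 else 0

/-- Proper motions: the finite products of main rotations. -/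
def properMotions {n : ℕ} (k : Fin n → ℝ) :
    Submonoid (Matrix (Fin (n + 1)) (Fin (n + 1)) ℝ) :=
  Submonoid.closure {M | ∃ (m : Fin n) (φ : ℝ), M = mainRotation k m φ}

/-- All motions, proper and improper: the products of proper motions and of the coordinate
reflections `diag(±1, …, ±1)`. -/
def motions {n : ℕ} (k : Fin n → ℝ) :
    Submonoid (Matrix (Fin (n + 1)) (Fin (n + 1)) ℝ) :=
  properMotions k ⊔ Submonoid.closure
    {M | ∃ d : Fin (n + 1) → ℝ, (∀ i, d i = 1 ∨ d i = -1) ∧ M = Matrix.diagonal d}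

/-- The image of a set of points of `ℝP^n` under a matrix. -/
def projImage {n : ℕ} (M : Matrix (Fin (n + 1)) (Fin (n + 1)) ℝ)
    (F : Set (ℙ ℝ (Fin (n + 1) → ℝ))) : Set (ℙ ℝ (Fin (n + 1) → ℝ)) :=
  {p | ∃ q ∈ F, p.submodule = q.submodule.map (Matrix.toLin' M)}

/-! ### Intrinsic volume -/

/-- The characteristics with every zero replaced by `ε`. -/
def regularize {n : ℕ} (k : Fin n → ℝ) (ε : ℝ) : Fin n → ℝ :=
  fun i => if k i = 0 then ε else k i

/-- The state matrix, with entries `(v_i ⊙ v_j) / K_i`, of vectors `v_1, …, v_n`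
(`v i` is the vector usually called `v_{i+1}`). -/
def stateMatrix {n : ℕ} (k : Fin n → ℝ) (v : Fin n → Fin (n + 1) → ℝ) :
    Matrix (Fin n) (Fin n) ℝ :=
  Matrix.of fun i j => odot k (v i) (v j) / K k i.succ

/-- The `n`-dimensional volume `√(det M)` of the parallelepiped on `n` vectors tangent to the
space, where `M` is their state matrix. A quotient by a vanishing `K_i` is understood formally:
the zero characteristics are taken as a parameter `ε ≠ 0`, and `ε` tends to `0`. If no
characteristic is zero, then nothing depends on `ε`. -/
def tangentVolume {n : ℕ} (k : Fin n → ℝ) (v : Fin n → Fin (n + 1) → ℝ) : ℝ :=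
  limUnder (𝓝[≠] (0 : ℝ)) fun ε => √(stateMatrix (regularize k ε) v).det

/-- A parametrized piece of the space: an injective `C¹` parametrization, defined on an open subset
of `ℝ^n`, together with a measurable subset of its domain. -/
structure Patch {n : ℕ} (k : Fin n → ℝ) where
  dom : Set (Fin n → ℝ)
  param : (Fin n → ℝ) → (Fin (n + 1) → ℝ)
  piece : Set (Fin n → ℝ)
  isOpen_dom : IsOpen dom
  contDiffOn : ContDiffOn ℝ 1 param dom
  injOn : InjOn param dom
  mapsTo : MapsTo param dom (sphere k)
  measurableSet_piece : MeasurableSet piece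
  piece_subset : piece ⊆ dom

/-- The set parametrized by a patch. -/
def Patch.carrier {n : ℕ} {k : Fin n → ℝ} (P : Patch k) : Set (Fin (n + 1) → ℝ) :=
  P.param '' P.piece

/-- The volume of a patch: the integral of the volume of the parallelepiped on the partial
derivatives of the parametrization. -/
def Patch.vol {n : ℕ} {k : Fin n → ℝ} (P : Patch k) : ℝ≥0∞ :=
  ∫⁻ u in P.piece,
    ENNReal.ofReal (tangentVolume k fun j => fderiv ℝ P.param u (Pi.single j 1))

/-- The intrinsic volume of a figure on the unit sphere: the infimum of the total volume of
countably many patches that cover it. -/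
def sphereVolume {n : ℕ} (k : Fin n → ℝ) (F : Set (Fin (n + 1) → ℝ)) : ℝ≥0∞ :=
  ⨅ (P : ℕ → Patch k) (_ : F ⊆ ⋃ i, (P i).carrier), ∑' i, (P i).vol

/-- The intrinsic volume of a figure in `𝔹^n ⊆ ℝP^n`. -/
def spaceVolume {n : ℕ} (k : Fin n → ℝ) (F : Set (ℙ ℝ (Fin (n + 1) → ℝ))) : ℝ≥0∞ :=
  ⨅ (P : ℕ → Patch k) (_ : ∀ p ∈ F, ∃ x ∈ ⋃ i, (P i).carrier, x ∈ p.submodule),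
    ∑' i, (P i).vol

/-- The cone with base `F` and vertex at the origin of `ℝ^{n+1}`. -/
def cone {n : ℕ} (F : Set (Fin (n + 1) → ℝ)) : Set (Fin (n + 1) → ℝ) :=
  {y | ∃ t ∈ Icc (0 : ℝ) 1, ∃ x ∈ F, y = t • x}

/-- `G` consists of normalized coordinate vectors of the points of `F`, one for each point. -/
def IsLift {n : ℕ} (k : Fin n → ℝ) (G : Set (Fin (n + 1) → ℝ))
    (F : Set (ℙ ℝ (Fin (n + 1) → ℝ))) : Prop :=
  G ⊆ sphere k ∧ (∀ x ∈ G, ∃ p ∈ F, x ∈ p.submodule) ∧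
    ∀ p ∈ F, ∃! x, x ∈ G ∧ x ∈ p.submodule

/-- The arc of `𝔹^1` between the parameters `α` and `β`. -/
def arc (κ α β : ℝ) : Set (Fin (1 + 1) → ℝ) :=
  (fun φ : ℝ => ![C κ φ, S κ φ]) '' Icc α β

end GeomSpace

end

namespace GeomSpace

/-! ### The product `⊙` -/

/-! For `p` on the sphere and `v_i` orthogonal to `p` under `⊙`, the intrinsic volume of the `v_i`
is `|det (p, v_1, …, v_n)|` (`tangentVolume_eq`): if no `K_i` vanishes, the Gram matrix of `(p, v)`
splits as `1 ⊕ (v_i ⊙ v_j)`, and in the degenerate case the regularized expression does not depend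
on `ε`.

The same determinant governs cones. The map `(t, u) ↦ t • p(u)` has Jacobian `t ^ n * det (p, ∂p)`,
and `∫₀¹ t ^ n = 1 / (n + 1)`, so a patch has `n + 1` times the Lebesgue volume of its cone
(`Patch.vol_eq_volume_cone`).

Subadditivity then bounds the intrinsic volume of any figure from below. For the upper bound, a
Borel figure is cut into disjoint graph patches (`sphereVolume_le_of_measurableSet`), and an
arbitrary one is enclosed in Borel figures by outer regularity (`sphereVolume_eq`). In projective
space a cover may pick the other representative; reflecting the missed part of the cone in the
origin repairs this (`spaceVolume_eq`).

Motions preserve `⊙` and have determinant `±1`, hence preserve volumes of cones and so all the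
volumes above. On `𝔹^1` the parameter `φ` is arc length, because `C² + κ S² = 1`. -/

lemma K_zero {n : ℕ} (k : Fin n → ℝ) : K k 0 = 1 := by simp [K]

lemma K_succ {n : ℕ} (k : Fin n → ℝ) (m : Fin n) : K k m.succ = K k m.castSucc * k m := by
  have : Finset.univ.filter (fun i : Fin n => (i : ℕ) < (m.succ : ℕ)) =
      insert m (Finset.univ.filter (fun i : Fin n => (i : ℕ) < (m.castSucc : ℕ))) := by
    ext i
    simp [Fin.ext_iff]
    omega
  rw [K, this, Finset.prod_insert (by simp), K, mul_comm]

lemma odot_smul_smul {n : ℕ} (k : Fin n → ℝ) (s t : ℝ) (x y : Fin (n + 1) → ℝ) :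
    odot k (s • x) (t • y) = s * t * odot k x y := by
  simp only [odot, Finset.mul_sum, Pi.smul_apply, smul_eq_mul]
  exact Finset.sum_congr rfl fun i _ => by ring

lemma continuous_odot_self {n : ℕ} (k : Fin n → ℝ) :
    Continuous fun x : Fin (n + 1) → ℝ => odot k x x := by
  unfold odot
  fun_prop

lemma isClosed_sphere {n : ℕ} (k : Fin n → ℝ) : IsClosed (sphere k) :=
  isClosed_eq (continuous_odot_self k) continuous_const

lemma ne_zero_of_mem_sphere {n : ℕ} {k : Fin n → ℝ} {x : Fin (n + 1) → ℝ} (hx : x ∈ sphere k) :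
    x ≠ 0 := by
  rintro rfl
  simp [sphere, odot] at hx

lemma sq_eq_one_of_smul_mem_sphere {n : ℕ} {k : Fin n → ℝ} {x : Fin (n + 1) → ℝ} {c : ℝ}
    (hx : x ∈ sphere k) (hc : c • x ∈ sphere k) : c ^ 2 = 1 := by
  simp only [sphere, mem_ofPred_eq] at hx hc
  rw [odot_smul_smul, hx] at hc
  linarith

/-! ### The volume of a tangent parallelepiped -/

/-- The determinant with rows `p, v_1, …, v_n`. -/
noncomputable def frameDet {n : ℕ} (p : Fin (n + 1) → ℝ) (v : Fin n → Fin (n + 1) → ℝ) : ℝ :=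
  (Matrix.of (Fin.cons p v : Fin (n + 1) → Fin (n + 1) → ℝ)).det

lemma frameDet_sub {n : ℕ} (p q : Fin (n + 1) → ℝ) (v : Fin n → Fin (n + 1) → ℝ) :
    frameDet (p - q) v = frameDet p v - frameDet q v := by
  simp only [frameDet, Matrix.det_succ_row_zero, ← Finset.sum_sub_distrib]
  refine Finset.sum_congr rfl fun j _ => ?_
  have h : ∀ w : Fin (n + 1) → ℝ,
      (Matrix.of (Fin.cons w v : Fin (n + 1) → Fin (n + 1) → ℝ)).submatrix Fin.succ j.succAbove =
        (Matrix.of v).submatrix id j.succAbove := fun w => by ext; simp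
  simp only [h, Matrix.of_apply, Fin.cons_zero, Pi.sub_apply]
  ring

/-- All rows lie in the kernel of the functional `p ⊙ ·`, which is nonzero because `p ⊙ p = 1`. -/
lemma frameDet_eq_zero {n : ℕ} {k : Fin n → ℝ} {p q : Fin (n + 1) → ℝ}
    {v : Fin n → Fin (n + 1) → ℝ} (hp : odot k p p = 1) (hq : odot k p q = 0)
    (hv : ∀ i, odot k p (v i) = 0) : frameDet q v = 0 := by
  rw [frameDet, ← Matrix.exists_mulVec_eq_zero_iff]
  refine ⟨fun j => K k j * p j, fun h => ?_, ?_⟩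
  · have h' : ∀ j, K k j * p j = 0 := fun j => congrFun h j
    simp [odot, h'] at hp
  · ext i
    have key : ∀ x : Fin (n + 1) → ℝ, x ⬝ᵥ (fun j => K k j * p j) = odot k p x := fun x =>
      Finset.sum_congr rfl fun j _ => by ring
    simp only [Matrix.mulVec, key, Pi.zero_apply]
    refine Fin.cases ?_ (fun j => ?_) i
    · exact hq
    · exact hv j

lemma regularize_ne_zero {n : ℕ} (k : Fin n → ℝ) {ε : ℝ} (hε : ε ≠ 0) (i : Fin n) :
    regularize k ε i ≠ 0 := by
  unfold regularize
  split_ifs <;> assumption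

lemma K_regularize_ne_zero {n : ℕ} (k : Fin n → ℝ) {ε : ℝ} (hε : ε ≠ 0) (m : Fin (n + 1)) :
    K (regularize k ε) m ≠ 0 :=
  Finset.prod_ne_zero_iff.2 fun i _ => regularize_ne_zero k hε i

lemma K_regularize {n : ℕ} {k : Fin n → ℝ} (ε : ℝ) {m : Fin (n + 1)} (hm : K k m ≠ 0) :
    K (regularize k ε) m = K k m := by
  refine Finset.prod_congr rfl fun i hi => ?_
  rw [regularize, if_neg (Finset.prod_ne_zero_iff.1 hm i hi)]

/-- The Gram determinant of an orthonormal vector `q` completed by vectors orthogonal to it. -/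
lemma det_stateMatrix {n : ℕ} {k : Fin n → ℝ} (hK : ∀ m, K k m ≠ 0) {q : Fin (n + 1) → ℝ}
    {v : Fin n → Fin (n + 1) → ℝ} (hq : odot k q q = 1) (hv : ∀ i, odot k q (v i) = 0) :
    (stateMatrix k v).det = frameDet q v ^ 2 := by
  set A : Matrix (Fin (n + 1)) (Fin (n + 1)) ℝ :=
    Matrix.of (Fin.cons q v : Fin (n + 1) → Fin (n + 1) → ℝ) with hA
  have hG : ∀ i j, (A * Matrix.diagonal (K k) * A.transpose) i j = odot k (A i) (A j) := by
    intro i j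
    rw [Matrix.mul_apply]
    refine Finset.sum_congr rfl fun l _ => ?_
    rw [Matrix.mul_diagonal, Matrix.transpose_apply]
    ring
  have h1 : (A * Matrix.diagonal (K k) * A.transpose).det =
      frameDet q v ^ 2 * ∏ i, K k i := by
    rw [Matrix.det_mul, Matrix.det_mul, Matrix.det_transpose, Matrix.det_diagonal, frameDet]
    ring
  -- The first row of the Gram matrix is `(1, 0, …, 0)`. The remaining minor has entries `v_i ⊙
  -- v_j`, and its row `i` is `K k i.succ` times that row of the state matrix.
  have h2 : (A * Matrix.diagonal (K k) * A.transpose).det =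
      (∏ i : Fin n, K k i.succ) * (stateMatrix k v).det := by
    rw [← Matrix.det_diagonal, ← Matrix.det_mul, Matrix.det_succ_row_zero, Fin.sum_univ_succ,
      Finset.sum_eq_zero, add_zero]
    · have e0 : odot k (A 0) (A 0) = 1 := hq
      rw [hG, e0]
      simp only [Fin.val_zero, pow_zero, one_mul]
      congr 1
      ext i j
      rw [Matrix.diagonal_mul, Matrix.submatrix_apply, hG]
      simp only [stateMatrix, Matrix.of_apply]
      rw [mul_div_cancel₀ _ (hK _)]
      rfl
    · intro j _
      have e0 : odot k (A 0) (A j.succ) = 0 := hv j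
      rw [hG, e0]
      ring
  rw [h1, Fin.prod_univ_succ, K_zero, one_mul, mul_comm] at h2
  exact (mul_left_cancel₀ (Finset.prod_ne_zero_iff.2 fun i _ => hK i.succ) h2).symm

/-- The limit in `tangentVolume` is that of a constant: the square root takes the same value for
every `ε ≠ 0`. -/
lemma tangentVolume_eq {n : ℕ} {k : Fin n → ℝ} {p : Fin (n + 1) → ℝ}
    {v : Fin n → Fin (n + 1) → ℝ} (hp : odot k p p = 1) (hv : ∀ i, odot k p (v i) = 0) :
    tangentVolume k v = |frameDet p v| := by
  have key : ∀ ε : ℝ, ε ≠ 0 → √(stateMatrix (regularize k ε) v).det = |frameDet p v| := by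
    intro ε hε
    -- `q` is `p` with the coordinates of zero weight erased. It is the unit normal for the
    -- regularized product, which pairs `q` with any vector exactly as `⊙` pairs `p` with it.
    set q : Fin (n + 1) → ℝ := fun j => K k j * p j / K (regularize k ε) j with hqdef
    have hqx : ∀ x, odot (regularize k ε) q x = odot k p x := fun x =>
      Finset.sum_congr rfl fun j _ => by
        rw [hqdef]
        field_simp [K_regularize_ne_zero k hε j]
    have hpq : odot k p q = 1 := by
      rw [← hp]
      refine Finset.sum_congr rfl fun j _ => ?_
      by_cases h : K k j = 0
      · simp [h]
      · simp only [hqdef, K_regularize ε h]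
        field_simp
    rw [det_stateMatrix (K_regularize_ne_zero k hε) (by rw [hqx, hpq])
      (fun i => by rw [hqx, hv]), Real.sqrt_sq_eq_abs]
    -- Replacing `q` by `p` is free: `q - p` is orthogonal to `p`, like all the `v_i`.
    have h0 : frameDet (q - p) v = 0 := by
      refine frameDet_eq_zero hp ?_ hv
      have : odot k p (q - p) = odot k p q - odot k p p := by
        simp only [odot, ← Finset.sum_sub_distrib, Pi.sub_apply]
        exact Finset.sum_congr rfl fun j _ => by ring
      rw [this, hpq, hp, sub_self]
    rw [frameDet_sub, sub_eq_zero] at h0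
    rw [h0]
  refine Tendsto.limUnder_eq (tendsto_const_nhds.congr' ?_)
  filter_upwards [self_mem_nhdsWithin] with ε hε using (key ε hε).symm

/-! ### Cones -/

lemma smul_mem_cone {n : ℕ} {F : Set (Fin (n + 1) → ℝ)} {x : Fin (n + 1) → ℝ} (hx : x ∈ F)
    {t : ℝ} (ht : t ∈ Icc (0 : ℝ) 1) : t • x ∈ cone F := ⟨t, ht, x, hx, rfl⟩

lemma cone_mono {n : ℕ} {F G : Set (Fin (n + 1) → ℝ)} (h : F ⊆ G) : cone F ⊆ cone G :=
  fun _ ⟨t, ht, x, hx, e⟩ => ⟨t, ht, x, h hx, e⟩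

lemma cone_iUnion {n : ℕ} {ι : Type*} (F : ι → Set (Fin (n + 1) → ℝ)) :
    cone (⋃ i, F i) = ⋃ i, cone (F i) := by
  ext y
  simp only [cone, mem_iUnion, mem_ofPred_eq]
  constructor
  · rintro ⟨t, ht, x, ⟨i, hi⟩, e⟩
    exact ⟨i, t, ht, x, hi, e⟩
  · rintro ⟨i, t, ht, x, hi, e⟩
    exact ⟨t, ht, x, ⟨i, hi⟩, e⟩

/-- The cone on a figure of the unit sphere, without its vertex, in polar coordinates. -/
lemma mem_cone_diff_zero {n : ℕ} {k : Fin n → ℝ} {F : Set (Fin (n + 1) → ℝ)}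
    (hF : F ⊆ sphere k) (y : Fin (n + 1) → ℝ) :
    y ∈ cone F \ {0} ↔ odot k y y ∈ Ioc (0 : ℝ) 1 ∧ (√(odot k y y))⁻¹ • y ∈ F := by
  constructor
  · rintro ⟨⟨t, ⟨ht0, ht1⟩, x, hx, rfl⟩, hy⟩
    have ht : 0 < t := lt_of_le_of_ne ht0 (by rintro rfl; simp at hy)
    have hxx : odot k x x = 1 := hF hx
    rw [odot_smul_smul, hxx, mul_one, Real.sqrt_mul_self ht0, smul_smul, inv_mul_cancel₀ ht.ne',
      one_smul]
    exact ⟨⟨by positivity, by nlinarith⟩, hx⟩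
  · rintro ⟨⟨h0, h1⟩, h⟩
    have hs : 0 < √(odot k y y) := Real.sqrt_pos.2 h0
    refine ⟨⟨√(odot k y y), ⟨hs.le, Real.sqrt_le_one.2 h1⟩, _, h, ?_⟩, ?_⟩
    · rw [smul_smul, mul_inv_cancel₀ hs.ne', one_smul]
    · rintro rfl
      simp [odot] at h0

lemma measurableSet_cone_diff_zero {n : ℕ} {k : Fin n → ℝ} {F : Set (Fin (n + 1) → ℝ)}
    (hF : F ⊆ sphere k) (hm : MeasurableSet F) : MeasurableSet (cone F \ {0}) := by
  have hc := (continuous_odot_self k).measurable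
  have : cone F \ {0} = (fun y => odot k y y) ⁻¹' Ioc (0 : ℝ) 1 ∩
      (fun y => (√(odot k y y))⁻¹ • y) ⁻¹' F := by
    ext y
    exact mem_cone_diff_zero hF y
  rw [this]
  exact (hc measurableSet_Ioc).inter ((hc.sqrt.inv.smul measurable_id) hm)

lemma disjoint_cone_diff_zero {n : ℕ} {k : Fin n → ℝ} {F G : Set (Fin (n + 1) → ℝ)}
    (hF : F ⊆ sphere k) (hG : G ⊆ sphere k) (h : Disjoint F G) :
    Disjoint (cone F \ {0}) (cone G \ {0}) :=
  disjoint_left.2 fun y hy hy' => disjoint_left.1 h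
    ((mem_cone_diff_zero hF y).1 hy).2 ((mem_cone_diff_zero hG y).1 hy').2

/-- The vertex is a null set. Without it, polar coordinates are defined and cones on disjoint bases
are disjoint. -/
lemma volume_diff_zero {n : ℕ} (A : Set (Fin (n + 1) → ℝ)) :
    volume (A \ {0}) = volume A :=
  measure_sdiff_null (measure_singleton 0)

/-! ### The volume of a patch and of its cone -/

lemma hasFDerivAt_odot_self {n : ℕ} (k : Fin n → ℝ) (x : Fin (n + 1) → ℝ) :
    HasFDerivAt (fun x : Fin (n + 1) → ℝ => odot k x x)
      (∑ i, (2 * (K k i * x i)) • ContinuousLinearMap.proj (R := ℝ) (φ := fun _ => ℝ) i) x := by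
  unfold odot
  refine HasFDerivAt.fun_sum fun i _ => ?_
  have h := hasFDerivAt_apply (𝕜 := ℝ) (F' := fun _ : Fin (n + 1) => ℝ) i x
  refine ((h.const_mul (K k i)).mul h).congr_fderiv ?_
  ext w
  simp
  ring

section Patch

variable {n : ℕ} {k : Fin n → ℝ} (P : Patch k)

lemma Patch.differentiableAt {u : Fin n → ℝ} (hu : u ∈ P.dom) : DifferentiableAt ℝ P.param u :=
  (P.contDiffOn.differentiableOn one_ne_zero).differentiableAt (P.isOpen_dom.mem_nhds hu)

/-- Differentiate `p ⊙ p = 1`. -/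
lemma Patch.odot_fderiv {u : Fin n → ℝ} (hu : u ∈ P.dom) (w : Fin n → ℝ) :
    odot k (P.param u) (fderiv ℝ P.param u w) = 0 := by
  have h1 := (hasFDerivAt_odot_self k (P.param u)).comp u (P.differentiableAt hu).hasFDerivAt
  have h2 : HasFDerivAt ((fun x => odot k x x) ∘ P.param) (0 : (Fin n → ℝ) →L[ℝ] ℝ) u :=
    (hasFDerivAt_const (1 : ℝ) u).congr_of_eventuallyEq
      (by filter_upwards [P.isOpen_dom.mem_nhds hu] with y hy using P.mapsTo hy)
  have h3 := congrArg (fun L => L w) (h1.unique h2)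
  simp only [ContinuousLinearMap.comp_apply, sum_apply,
    smul_apply, ContinuousLinearMap.proj_apply, smul_eq_mul,
    zero_apply, mul_assoc, ← Finset.mul_sum] at h3
  simp only [odot, mul_assoc]
  linarith

/-- The determinant of position and partial derivatives of a parametrization. -/
noncomputable def Patch.jacobian (u : Fin n → ℝ) : ℝ :=
  frameDet (P.param u) fun j => fderiv ℝ P.param u (Pi.single j 1)

lemma Patch.vol_eq : P.vol = ∫⁻ u in P.piece, ENNReal.ofReal |P.jacobian u| := by
  refine setLIntegral_congr_fun P.measurableSet_piece fun u hu => ?_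
  rw [tangentVolume_eq (P.mapsTo (P.piece_subset hu))
    fun i => P.odot_fderiv (P.piece_subset hu) _, Patch.jacobian]

lemma Patch.continuousOn_jacobian : ContinuousOn P.jacobian P.dom := by
  have h := P.contDiffOn.continuousOn_fderiv_of_isOpen P.isOpen_dom le_rfl
  have hA : ContinuousOn (fun u => Matrix.of (Fin.cons (P.param u)
      (fun j => fderiv ℝ P.param u (Pi.single j 1)) : Fin (n + 1) → Fin (n + 1) → ℝ)) P.dom := by
    refine continuousOn_pi.2 fun i => Fin.cases P.contDiffOn.continuousOn (fun j => ?_) i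
    exact h.clm_apply continuousOn_const
  exact (continuous_id.matrix_det).comp_continuousOn hA

lemma Patch.carrier_subset : P.carrier ⊆ sphere k := by
  rintro _ ⟨u, hu, rfl⟩
  exact P.mapsTo (P.piece_subset hu)

/-- An injective continuous image of a Borel set is Borel (Lusin–Souslin); injectivity of patches is
essential here. -/
lemma Patch.measurableSet_carrier : MeasurableSet P.carrier :=
  P.measurableSet_piece.image_of_continuousOn_injOn
    (P.contDiffOn.continuousOn.mono P.piece_subset) (P.injOn.mono P.piece_subset)

/-- The derivative of `z ↦ z_0 • p(z_1, …, z_n)`. -/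
noncomputable def Patch.coneDeriv (z : Fin (n + 1) → ℝ) :
    (Fin (n + 1) → ℝ) →L[ℝ] (Fin (n + 1) → ℝ) :=
  z 0 • (fderiv ℝ P.param (Fin.tail z)).comp
      (ContinuousLinearMap.pi fun i : Fin n => ContinuousLinearMap.proj i.succ) +
    (ContinuousLinearMap.proj (R := ℝ) (φ := fun _ : Fin (n + 1) => ℝ) 0).smulRight
      (P.param (Fin.tail z))

lemma Patch.hasFDerivAt_cone {z : Fin (n + 1) → ℝ} (hz : Fin.tail z ∈ P.dom) :
    HasFDerivAt (fun z : Fin (n + 1) → ℝ => z 0 • P.param (Fin.tail z)) (P.coneDeriv z) z := by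
  have ht : HasFDerivAt (fun z : Fin (n + 1) → ℝ => (Fin.tail z : Fin n → ℝ))
      (ContinuousLinearMap.pi fun i : Fin n => ContinuousLinearMap.proj (R := ℝ)
        (φ := fun _ : Fin (n + 1) => ℝ) i.succ) z :=
    ContinuousLinearMap.hasFDerivAt (ContinuousLinearMap.pi fun i : Fin n =>
      ContinuousLinearMap.proj (R := ℝ) (φ := fun _ : Fin (n + 1) => ℝ) i.succ)
  have h0 := hasFDerivAt_apply (𝕜 := ℝ) (F' := fun _ : Fin (n + 1) => ℝ) 0 z
  exact h0.smul ((P.differentiableAt hz).hasFDerivAt.comp z ht)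

/-- The radial direction is sent to `p`, and each of the other `n` coordinate directions to `z 0 •
∂_j p`. -/
lemma Patch.det_coneDeriv (z : Fin (n + 1) → ℝ) :
    (P.coneDeriv z).det = z 0 ^ n * P.jacobian (Fin.tail z) := by
  have h0 : P.coneDeriv z (Pi.single 0 1) = P.param (Fin.tail z) := by
    have : (fun i : Fin n => (Pi.single 0 1 : Fin (n + 1) → ℝ) i.succ) = 0 := by
      ext i; simp
    simp only [Patch.coneDeriv, add_apply, smul_apply,
      ContinuousLinearMap.comp_apply, ContinuousLinearMap.smulRight_apply,
      ContinuousLinearMap.proj_apply, ContinuousLinearMap.coe_pi', this]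
    simp
  have hs : ∀ j : Fin n, P.coneDeriv z (Pi.single j.succ 1) =
      z 0 • fderiv ℝ P.param (Fin.tail z) (Pi.single j 1) := by
    intro j
    have : (fun i : Fin n => (Pi.single j.succ 1 : Fin (n + 1) → ℝ) i.succ) = Pi.single j 1 := by
      ext i
      simp [Pi.single_apply]
    simp only [Patch.coneDeriv, add_apply, smul_apply,
      ContinuousLinearMap.comp_apply, ContinuousLinearMap.smulRight_apply,
      ContinuousLinearMap.proj_apply, ContinuousLinearMap.coe_pi', this]
    simp
  -- The images of the basis vectors are columns of the matrix but rows in `frameDet`, hence the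
  -- transpose.
  have hM : (LinearMap.toMatrix' (P.coneDeriv z : (Fin (n + 1) → ℝ) →ₗ[ℝ] _)).transpose =
      Matrix.diagonal (Fin.cons 1 fun _ => z 0) *
        Matrix.of (Fin.cons (P.param (Fin.tail z))
          (fun j => fderiv ℝ P.param (Fin.tail z) (Pi.single j 1)) :
            Fin (n + 1) → Fin (n + 1) → ℝ) := by
    ext i j
    rw [Matrix.transpose_apply, LinearMap.toMatrix'_apply, Matrix.diagonal_mul]
    refine Fin.cases ?_ (fun i => ?_) i
    · simpa [Pi.single_apply] using congrFun h0 j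
    · simpa [Pi.single_apply] using congrFun (hs i) j
  have hd : (P.coneDeriv z).det =
      (LinearMap.toMatrix' (P.coneDeriv z : (Fin (n + 1) → ℝ) →ₗ[ℝ] _)).det :=
    (LinearMap.det_toMatrix' _).symm
  rw [hd, ← Matrix.det_transpose, hM, Matrix.det_mul, Matrix.det_diagonal, Fin.prod_univ_succ]
  simp [Patch.jacobian, frameDet]

lemma lintegral_pow_Ioc (n : ℕ) :
    ∫⁻ t in Ioc (0 : ℝ) 1, ENNReal.ofReal (t ^ n) = ((n : ℝ≥0∞) + 1)⁻¹ := by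
  rw [← ofReal_integral_eq_lintegral_ofReal, ← intervalIntegral.integral_of_le zero_le_one,
    integral_pow]
  · rw [one_pow, zero_pow n.succ_ne_zero, sub_zero, one_div,
      ENNReal.ofReal_inv_of_pos (by positivity)]
    norm_cast
  · exact ((continuous_pow n).integrableOn_Icc (a := (0 : ℝ)) (b := 1)).mono_set Ioc_subset_Icc_self
  · filter_upwards [ae_restrict_mem measurableSet_Ioc] with t ht using pow_nonneg ht.1.le n

/-- Change of variables along `(t, u) ↦ t • p(u)`, then Tonelli on the product of `(0, 1]` and the
piece. -/
lemma Patch.volume_cone : volume (cone P.carrier) = ((n : ℝ≥0∞) + 1)⁻¹ * P.vol := by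
  set f : (Fin (n + 1) → ℝ) → (Fin (n + 1) → ℝ) := fun z => z 0 • P.param (Fin.tail z) with hf
  set e := MeasurableEquiv.piFinSuccAbove (fun _ : Fin (n + 1) => ℝ) 0 with he
  have hp : MeasurePreserving e := volume_preserving_piFinSuccAbove (fun _ : Fin (n + 1) => ℝ) 0
  have e1 : ∀ z, (e z).1 = z 0 := fun z => rfl
  have e2 : ∀ z, (e z).2 = Fin.tail z := fun z => by
    ext i; simp [he, MeasurableEquiv.piFinSuccAbove, Fin.tail, Fin.insertNthEquiv]
  -- The value `t = 0` is left out, since there everything collapses to the vertex.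
  set D : Set (Fin (n + 1) → ℝ) := e ⁻¹' (Ioc (0 : ℝ) 1 ×ˢ P.piece) with hD
  have memD : ∀ z, z ∈ D ↔ z 0 ∈ Ioc (0 : ℝ) 1 ∧ Fin.tail z ∈ P.piece := fun z => by
    rw [hD, mem_preimage, mem_prod, e1, e2]
  have mD : MeasurableSet D := e.measurable (measurableSet_Ioc.prod P.measurableSet_piece)
  have inj : InjOn f D := by
    intro z hz w hw h
    obtain ⟨⟨hz0, -⟩, hz⟩ := (memD z).1 hz
    obtain ⟨⟨hw0, -⟩, hw⟩ := (memD w).1 hw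
    have hz' : odot k (P.param (Fin.tail z)) (P.param (Fin.tail z)) = 1 :=
      P.mapsTo (P.piece_subset hz)
    have hw' : odot k (P.param (Fin.tail w)) (P.param (Fin.tail w)) = 1 :=
      P.mapsTo (P.piece_subset hw)
    -- Evaluating `x ⊙ x` recovers `t ^ 2`, and `t > 0`.
    have h0 : z 0 = w 0 := by
      have := congrArg (fun x => odot k x x) h
      simp only [hf, odot_smul_smul, hz', hw', mul_one] at this
      nlinarith
    have h1 : P.param (Fin.tail z) = P.param (Fin.tail w) := by
      simp only [hf, h0] at h
      exact smul_right_injective _ hw0.ne' h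
    have h2 := P.injOn (P.piece_subset hz) (P.piece_subset hw) h1
    rw [← Fin.cons_self_tail z, ← Fin.cons_self_tail w, h0, h2]
  have img : f '' D = cone P.carrier \ {0} := by
    ext y
    constructor
    · rintro ⟨z, hz, rfl⟩
      obtain ⟨⟨hz0, hz1⟩, hz⟩ := (memD z).1 hz
      exact ⟨⟨z 0, ⟨hz0.le, hz1⟩, _, ⟨_, hz, rfl⟩, rfl⟩, smul_ne_zero hz0.ne'
        (ne_zero_of_mem_sphere (P.mapsTo (P.piece_subset hz)))⟩
    · rintro ⟨⟨t, ⟨ht0, ht1⟩, _, ⟨u, hu, rfl⟩, rfl⟩, hy⟩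
      have ht : 0 < t := lt_of_le_of_ne ht0 (by rintro rfl; simp at hy)
      refine ⟨Fin.cons t u, (memD _).2 ⟨⟨ht, ht1⟩, ?_⟩, ?_⟩
      · simpa using hu
      · simp [hf]
  rw [← volume_diff_zero, ← img, ← lintegral_abs_det_fderiv_eq_addHaar_image volume mD
    (fun z hz => (P.hasFDerivAt_cone (P.piece_subset ((memD z).1 hz).2)).hasFDerivWithinAt) inj]
  have step : ∫⁻ z in D, ENNReal.ofReal |(P.coneDeriv z).det| =
      ∫⁻ z in D, (fun w : ℝ × (Fin n → ℝ) =>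
        ENNReal.ofReal (w.1 ^ n) * ENNReal.ofReal |P.jacobian w.2|) (e z) := by
    refine setLIntegral_congr_fun mD fun z hz => ?_
    have hz0 : 0 ≤ z 0 ^ n := pow_nonneg ((memD z).1 hz).1.1.le n
    simp only [e1, e2]
    rw [P.det_coneDeriv, abs_mul, abs_of_nonneg hz0, ENNReal.ofReal_mul hz0]
  rw [step]
  refine (hp.setLIntegral_comp_preimage_emb e.measurableEmbedding (fun w : ℝ × (Fin n → ℝ) =>
    ENNReal.ofReal (w.1 ^ n) * ENNReal.ofReal |P.jacobian w.2|) _).trans ?_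
  rw [Measure.volume_eq_prod, ← Measure.prod_restrict,
    lintegral_prod_mul (f := fun t : ℝ => ENNReal.ofReal (t ^ n))
      (g := fun u => ENNReal.ofReal |P.jacobian u|), lintegral_pow_Ioc, P.vol_eq]
  · exact (continuous_pow n).measurable.ennreal_ofReal.aemeasurable
  · exact ((P.continuousOn_jacobian.mono P.piece_subset).abs.aemeasurable
      P.measurableSet_piece).ennreal_ofReal

lemma Patch.vol_eq_volume_cone : P.vol = ((n : ℝ≥0∞) + 1) * volume (cone P.carrier) := by
  rw [P.volume_cone, ← mul_assoc, ENNReal.mul_inv_cancel (by simp) (by finiteness), one_mul]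

end Patch

/-! ### Covering the unit sphere by graphs -/

section Graph

variable {n : ℕ} (k : Fin n → ℝ) (j : Fin (n + 1)) (s : ℝ)

/-- The square of the coordinate `x_j` of a point of the unit sphere with other coordinates `u`. -/
noncomputable def graphSq (u : Fin n → ℝ) : ℝ :=
  (1 - ∑ i, K k (j.succAbove i) * u i ^ 2) / K k j

/-- The unit sphere as a graph over the coordinates other than `x_j`. -/
noncomputable def graphParam (u : Fin n → ℝ) : Fin (n + 1) → ℝ :=
  Fin.insertNth (α := fun _ => ℝ) j (s * √(graphSq k j u)) u

/-- The part of the unit sphere where `x_j` has the sign of `s`. -/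
def graphSet : Set (Fin (n + 1) → ℝ) := {x | x ∈ sphere k ∧ K k j ≠ 0 ∧ 0 < s * x j}

lemma contDiff_graphSq : ContDiff ℝ 1 (graphSq k j) := by
  unfold graphSq
  fun_prop

lemma continuous_graphParam : Continuous (graphParam k j s) := by
  refine continuous_pi fun i => Fin.succAboveCases j ?_ (fun i => ?_) i
  · simp only [graphParam, Fin.insertNth_apply_same]
    exact continuous_const.mul (contDiff_graphSq k j).continuous.sqrt
  · simp only [graphParam, Fin.insertNth_apply_succAbove]
    exact continuous_apply i

lemma contDiffOn_graphParam : ContDiffOn ℝ 1 (graphParam k j s) {u | 0 < graphSq k j u} := by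
  refine contDiffOn_pi.2 fun i => Fin.succAboveCases j ?_ (fun i => ?_) i
  · simp only [graphParam, Fin.insertNth_apply_same]
    exact contDiffOn_const.mul ((contDiff_graphSq k j).contDiffOn.sqrt fun u hu => ne_of_gt hu)
  · simp only [graphParam, Fin.insertNth_apply_succAbove]
    exact (contDiff_apply ℝ ℝ i).contDiffOn

lemma graphParam_injective : Function.Injective (graphParam k j s) :=
  fun u w h => funext fun i => by simpa [graphParam] using congrFun h (j.succAbove i)

lemma odot_self_insertNth (t : ℝ) (u : Fin n → ℝ) :
    odot k (Fin.insertNth (α := fun _ => ℝ) j t u) (Fin.insertNth (α := fun _ => ℝ) j t u) =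
      K k j * t ^ 2 + ∑ i, K k (j.succAbove i) * u i ^ 2 := by
  rw [odot, Fin.sum_univ_succAbove _ j]
  simp [mul_assoc, sq]

variable {k j s}

/-- Division by zero gives `0`, so for `K k j = 0` the domain of the graph is empty. -/
lemma ne_zero_of_graphSq_pos {u : Fin n → ℝ} (hu : 0 < graphSq k j u) : K k j ≠ 0 := by
  intro h
  simp [graphSq, h] at hu

lemma graphParam_mem_graphSet (hs : s ^ 2 = 1) {u : Fin n → ℝ} (hu : 0 < graphSq k j u) :
    graphParam k j s u ∈ graphSet k j s := by
  have hK := ne_zero_of_graphSq_pos hu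
  refine ⟨?_, hK, ?_⟩
  · change odot k _ _ = 1
    rw [graphParam, odot_self_insertNth, mul_pow, hs, Real.sq_sqrt hu.le, graphSq]
    field_simp
    ring
  · rw [graphParam, Fin.insertNth_apply_same, ← mul_assoc, ← sq, hs, one_mul]
    exact Real.sqrt_pos.2 hu

lemma exists_graphParam_eq (hs : s ^ 2 = 1) {x : Fin (n + 1) → ℝ} (hx : x ∈ graphSet k j s) :
    ∃ u, 0 < graphSq k j u ∧ graphParam k j s u = x := by
  obtain ⟨hx, hK, hpos⟩ := hx
  have h1 : K k j * x j ^ 2 + ∑ i, K k (j.succAbove i) * j.removeNth x i ^ 2 = 1 := by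
    rw [← odot_self_insertNth, Fin.insertNth_self_removeNth]
    exact hx
  have h2 : graphSq k j (j.removeNth x) = (s * x j) ^ 2 := by
    rw [graphSq, ← h1, mul_pow, hs]
    field_simp
    ring
  refine ⟨j.removeNth x, h2 ▸ by positivity, ?_⟩
  rw [graphParam, h2, Real.sqrt_sq hpos.le, ← mul_assoc, ← sq, hs, one_mul,
    Fin.insertNth_self_removeNth]

/-- The patch given by a graph and a Borel set of the sphere. -/
noncomputable def graphPatch (hs : s ^ 2 = 1) {B : Set (Fin (n + 1) → ℝ)} (hB : MeasurableSet B) :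
    Patch k where
  dom := {u | 0 < graphSq k j u}
  param := graphParam k j s
  piece := graphParam k j s ⁻¹' B ∩ {u | 0 < graphSq k j u}
  isOpen_dom := isOpen_lt continuous_const (contDiff_graphSq k j).continuous
  contDiffOn := contDiffOn_graphParam k j s
  injOn := (graphParam_injective k j s).injOn
  mapsTo := fun _ hu => (graphParam_mem_graphSet hs hu).1
  measurableSet_piece := ((continuous_graphParam k j s).measurable hB).inter
    (isOpen_lt continuous_const (contDiff_graphSq k j).continuous).measurableSet
  piece_subset := inter_subset_right

lemma carrier_graphPatch (hs : s ^ 2 = 1) {B : Set (Fin (n + 1) → ℝ)} (hB : MeasurableSet B) :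
    (graphPatch (k := k) (j := j) hs hB).carrier = B ∩ graphSet k j s := by
  ext x
  constructor
  · rintro ⟨u, ⟨h1, h2⟩, rfl⟩
    exact ⟨h1, graphParam_mem_graphSet hs h2⟩
  · rintro ⟨hxB, hx⟩
    obtain ⟨u, hu, rfl⟩ := exists_graphParam_eq hs hx
    exact ⟨u, ⟨hxB, hu⟩, rfl⟩

end Graph

lemma measurableSet_graphSet {n : ℕ} (k : Fin n → ℝ) (j : Fin (n + 1)) (s : ℝ) :
    MeasurableSet (graphSet k j s) :=
  (isClosed_sphere k).measurableSet.inter ((MeasurableSet.const _).inter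
    (measurableSet_lt measurable_const (measurable_const.mul (measurable_pi_apply j))))

/-- Some term of `x ⊙ x = 1` is nonzero. The index `i` encodes the coordinate `i / 2` and, by its
parity, the sign. Over all of `ℕ` the graph sets repeat cyclically, which is harmless once they are
made disjoint. -/
lemma exists_mem_graphSet {n : ℕ} {k : Fin n → ℝ} {x : Fin (n + 1) → ℝ} (hx : x ∈ sphere k) :
    ∃ i : ℕ, x ∈ graphSet k (Fin.ofNat (n + 1) (i / 2)) ((-1) ^ i) := by
  obtain ⟨j, -, hj⟩ : ∃ j ∈ Finset.univ, K k j * x j * x j ≠ 0 :=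
    Finset.exists_ne_zero_of_sum_ne_zero (by
      have : odot k x x = 1 := hx
      rw [odot] at this
      simp [this])
  have hK : K k j ≠ 0 := fun h => hj (by simp [h])
  have hxj : x j ≠ 0 := fun h => hj (by simp [h])
  rcases lt_or_gt_of_ne hxj with h | h
  · refine ⟨2 * j + 1, hx, ?_⟩
    have : (2 * (j : ℕ) + 1) / 2 = j := by omega
    rw [this, Fin.ofNat_eq_cast, Fin.cast_val_eq_self, pow_succ, pow_mul]
    exact ⟨hK, by simpa using h⟩
  · refine ⟨2 * j, hx, ?_⟩
    have : (2 * (j : ℕ)) / 2 = j := by omega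
    rw [this, Fin.ofNat_eq_cast, Fin.cast_val_eq_self, pow_mul]
    exact ⟨hK, by simpa using h⟩

/-! ### The volume of a figure on the unit sphere -/

section Volume

variable {n : ℕ} {k : Fin n → ℝ}

lemma volume_cone_iUnion_carrier_le (P : ℕ → Patch k) :
    ((n : ℝ≥0∞) + 1) * volume (cone (⋃ i, (P i).carrier)) ≤ ∑' i, (P i).vol := by
  simp only [Patch.vol_eq_volume_cone, ENNReal.tsum_mul_left, cone_iUnion]
  gcongr
  exact measure_iUnion_le _

/-- `H` is cut along the disjointed graph sets. The pieces are Borel, so their cones without vertex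
are disjoint measurable subsets of `cone H` and their volumes add up. -/
lemma sphereVolume_le_of_measurableSet {H F : Set (Fin (n + 1) → ℝ)} (hH : MeasurableSet H)
    (hHs : H ⊆ sphere k) (hF : F ⊆ H) :
    sphereVolume k F ≤ ((n : ℝ≥0∞) + 1) * volume (cone H) := by
  have hs : ∀ i : ℕ, ((-1 : ℝ) ^ i) ^ 2 = 1 := fun i => by
    rw [← pow_mul, mul_comm, pow_mul]; simp
  set D : ℕ → Set (Fin (n + 1) → ℝ) := fun i =>
    graphSet k (Fin.ofNat (n + 1) (i / 2)) ((-1) ^ i) with hD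
  have hm : ∀ i, MeasurableSet (H ∩ disjointed D i) := fun i =>
    hH.inter (MeasurableSet.disjointed (fun i => measurableSet_graphSet k _ _) i)
  set P : ℕ → Patch k := fun i =>
    graphPatch (j := Fin.ofNat (n + 1) (i / 2)) (hs i) (hm i) with hP
  have hc : ∀ i, (P i).carrier = H ∩ disjointed D i := fun i => by
    rw [hP, carrier_graphPatch, inter_eq_left]
    exact inter_subset_right.trans (disjointed_subset D i)
  have hU : ⋃ i, (P i).carrier = H := by
    simp only [hc, ← inter_iUnion, iUnion_disjointed]
    refine inter_eq_left.2 fun x hx => mem_iUnion.2 (exists_mem_graphSet (hHs hx))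
  refine (iInf₂_le P (hU.symm ▸ hF)).trans ?_
  simp only [Patch.vol_eq_volume_cone, ENNReal.tsum_mul_left]
  gcongr
  have hd : Pairwise (Function.onFun Disjoint fun i => cone (P i).carrier \ {0}) := fun i l hil =>
    disjoint_cone_diff_zero (P i).carrier_subset (P l).carrier_subset (by
      rw [hc, hc]
      exact (disjoint_disjointed D hil).mono inter_subset_right inter_subset_right)
  calc ∑' i, volume (cone (P i).carrier) = ∑' i, volume (cone (P i).carrier \ {0}) := by
        simp only [volume_diff_zero]
    _ = volume (⋃ i, cone (P i).carrier \ {0}) := (measure_iUnion hd fun i =>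
        measurableSet_cone_diff_zero (P i).carrier_subset (P i).measurableSet_carrier).symm
    _ ≤ volume (cone H) := measure_mono (iUnion_subset fun i => sdiff_subset.trans
        (cone_mono (hc i ▸ inter_subset_left)))

/-- By compactness of `[0, 1]`. This turns an open neighbourhood of a cone into an open
neighbourhood of its base whose cone stays inside. -/
lemma isOpen_segment_subset {U : Set (Fin (n + 1) → ℝ)} (hU : IsOpen U) :
    IsOpen {x : Fin (n + 1) → ℝ | ∀ t ∈ Icc (0 : ℝ) 1, t • x ∈ U} := by
  rw [isOpen_iff_mem_nhds]
  intro x hx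
  exact isCompact_Icc.eventually_forall_of_forall_eventually fun t ht =>
    (continuous_snd.smul continuous_fst).continuousAt.eventually (hU.mem_nhds (hx t ht))

/-- `F` need not be measurable: `volume (cone F)` is the infimum over open `U ⊇ cone F`, and each
`U` contains the cone of a Borel figure containing `F`. -/
theorem sphereVolume_eq {F : Set (Fin (n + 1) → ℝ)} (hF : F ⊆ sphere k) :
    sphereVolume k F = ((n : ℝ≥0∞) + 1) * volume (cone F) := by
  refine le_antisymm ?_ (le_iInf₂ fun P hP => le_trans ?_ (volume_cone_iUnion_carrier_le P))
  · have h : ∀ U, cone F ⊆ U → IsOpen U →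
        sphereVolume k F ≤ ((n : ℝ≥0∞) + 1) * volume U := by
      intro U hFU hU
      have hV := isOpen_segment_subset hU
      refine (sphereVolume_le_of_measurableSet ((isClosed_sphere k).measurableSet.inter
        hV.measurableSet) inter_subset_left fun x hx =>
          ⟨hF hx, fun t ht => hFU (smul_mem_cone hx ht)⟩).trans ?_
      gcongr
      rintro _ ⟨t, ht, x, ⟨-, hx⟩, rfl⟩
      exact hx t ht
    rw [mul_comm, ← ENNReal.div_le_iff (by simp) (by finiteness), Set.measure_eq_iInf_isOpen]
    refine le_iInf₂ fun U hFU => le_iInf fun hU => ?_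
    rw [ENNReal.div_le_iff (by simp) (by finiteness), mul_comm]
    exact h U hFU hU
  · gcongr
    exact cone_mono hP

/-! ### The volume of a figure in the projective space -/

lemma eq_or_eq_neg_of_mem_submodule {p : ℙ ℝ (Fin (n + 1) → ℝ)} {x y : Fin (n + 1) → ℝ}
    (hx : x ∈ p.submodule) (hy : y ∈ p.submodule) (hxs : x ∈ sphere k) (hys : y ∈ sphere k) :
    y = x ∨ y = -x := by
  have hp : p = Projectivization.mk ℝ x (ne_zero_of_mem_sphere hxs) := by
    rw [← p.mk_rep, Projectivization.submodule_mk, Submodule.mem_span_singleton] at hx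
    obtain ⟨a, ha⟩ := hx
    rw [← p.mk_rep]
    refine ((Projectivization.mk_eq_mk_iff' ℝ _ _ _ _).2 ⟨a, ha⟩).symm
  rw [hp, Projectivization.submodule_mk, Submodule.mem_span_singleton] at hy
  obtain ⟨c, rfl⟩ := hy
  rcases sq_eq_one_iff.1 (sq_eq_one_of_smul_mem_sphere hxs hys) with h | h
  · simp [h]
  · simp [h]

/-- A cover of `G` covers `F`, which gives one inequality. Conversely, a cover `E` of `F` may
contain `-x` instead of `x ∈ G`, so the part of `cone G` missed by `cone E` is reflected into `cone
E`. Measurability of `cone G` makes the volumes of the kept and the reflected part add. -/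
theorem spaceVolume_eq {F : Set (ℙ ℝ (Fin (n + 1) → ℝ))} {G : Set (Fin (n + 1) → ℝ)}
    (hG : IsLift k G F) (hm : NullMeasurableSet (cone G) volume) :
    spaceVolume k F = ((n : ℝ≥0∞) + 1) * volume (cone G) := by
  obtain ⟨hGs, hGF, huniq⟩ := hG
  refine le_antisymm ?_ (le_iInf₂ fun P hP => le_trans ?_ (volume_cone_iUnion_carrier_le P))
  · rw [← sphereVolume_eq hGs]
    refine le_iInf₂ fun P hP => iInf₂_le P fun p hp => ?_
    obtain ⟨x, ⟨hxG, hxp⟩, -⟩ := huniq p hp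
    exact ⟨x, hP hxG, hxp⟩
  · set E := ⋃ i, (P i).carrier with hE
    have hEs : E ⊆ sphere k := iUnion_subset fun i => (P i).carrier_subset
    have hEm : MeasurableSet (cone E \ {0}) := measurableSet_cone_diff_zero hEs
      (MeasurableSet.iUnion fun i => (P i).measurableSet_carrier)
    -- The point of `x` has only the representatives `±x`. The cover must contain `-x`, while the
    -- lift, having just one of them, omits it.
    have hGE : ∀ x ∈ G, x ∉ E → -x ∈ E ∧ -x ∉ G := by
      intro x hx hxE
      obtain ⟨p, hp, hxp⟩ := hGF x hx
      obtain ⟨y, hyE, hyp⟩ := hP p hp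
      refine ⟨?_, fun hx' => ?_⟩
      · rcases eq_or_eq_neg_of_mem_submodule hxp hyp (hGs hx) (hEs hyE) with rfl | rfl
        · exact absurd hyE hxE
        · exact hyE
      · have h1 : -x = x := (huniq p hp).unique ⟨hx', p.submodule.neg_mem hxp⟩ ⟨hx, hxp⟩
        exact ne_zero_of_mem_sphere (hGs hx) (self_eq_neg.1 h1.symm)
    refine mul_le_mul' le_rfl ?_
    set A := cone G \ {0} with hA
    have hAm : NullMeasurableSet A volume := hm.diff (measurableSet_singleton 0).nullMeasurableSet
    set B := -(A \ (cone E \ {0})) with hB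
    have hBm : NullMeasurableSet B volume :=
      (hAm.diff hEm.nullMeasurableSet).preimage (Measure.measurePreserving_neg volume).quasiMeasurePreserving
    have hnegB : ∀ y ∈ B, (√(odot k y y))⁻¹ • y ∈ E ∧ (√(odot k y y))⁻¹ • y ∉ G ∧
        odot k y y ∈ Ioc (0 : ℝ) 1 := by
      intro y hy
      obtain ⟨h1, h2⟩ : -y ∈ A ∧ -y ∉ cone E \ {0} := hy
      have e : odot k (-y) (-y) = odot k y y := by simp [odot]
      rw [hA, mem_cone_diff_zero hGs, e] at h1
      rw [mem_cone_diff_zero hEs, e] at h2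
      have := hGE _ h1.2 fun h => h2 ⟨h1.1, h⟩
      rw [smul_neg, neg_neg] at this
      exact ⟨this.1, this.2, h1.1⟩
    have hBE : B ⊆ cone E := fun y hy =>
      ((mem_cone_diff_zero hEs y).2 ⟨(hnegB y hy).2.2, (hnegB y hy).1⟩).1
    -- The radial projection of a point of `B` is not in `G`, so `B` does not meet `cone G \ {0}`.
    have hdisj : Disjoint (A ∩ (cone E \ {0})) B := disjoint_left.2 fun y hy hy' =>
      (hnegB y hy').2.1 ((mem_cone_diff_zero hGs y).1 hy.1).2
    calc volume (cone G) = volume A := (volume_diff_zero _).symm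
      _ = volume (A ∩ (cone E \ {0})) + volume (A \ (cone E \ {0})) :=
        (measure_inter_add_sdiff A hEm).symm
      _ = volume (A ∩ (cone E \ {0})) + volume B := by rw [hB, Measure.measure_neg]
      _ = volume (A ∩ (cone E \ {0}) ∪ B) := (measure_union₀ hBm hdisj.aedisjoint).symm
      _ ≤ volume (cone E) := measure_mono
        (union_subset (inter_subset_right.trans sdiff_subset) hBE)

end Volume

/-! ### The generalized trigonometric functions -/

lemma C_one : C 1 = Real.cos := by
  ext x
  rw [C, Real.cos_eq_tsum]

lemma S_one : S 1 = Real.sin := by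
  ext x
  rw [S, Real.sin_eq_tsum]

lemma C_neg_one : C (-1) = Real.cosh := by
  ext x
  rw [C, Real.cosh_eq_tsum]
  simp

lemma S_neg_one : S (-1) = Real.sinh := by
  ext x
  rw [S, Real.sinh_eq_tsum]
  simp

lemma C_zero : C 0 = fun _ => 1 := by
  ext x
  rw [C, tsum_eq_single 0 fun m hm => by simp [hm]]
  simp

lemma S_zero : S 0 = id := by
  ext x
  rw [S, tsum_eq_single 0 fun m hm => by simp [hm]]
  simp

lemma C_sq_add_S_sq {κ : ℝ} (hκ : κ = -1 ∨ κ = 0 ∨ κ = 1) (x : ℝ) :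
    C κ x ^ 2 + κ * S κ x ^ 2 = 1 := by
  rcases hκ with rfl | rfl | rfl
  · rw [C_neg_one, S_neg_one, Real.cosh_sq]; ring
  · simp [C_zero]
  · rw [C_one, S_one, one_mul, Real.cos_sq_add_sin_sq]

lemma C_neg (κ x : ℝ) : C κ (-x) = C κ x := by
  simp [C, pow_mul]

lemma S_neg (κ x : ℝ) : S κ (-x) = -S κ x := by
  simp only [S, ← tsum_neg]
  refine tsum_congr fun m => ?_
  rw [pow_succ, pow_succ, pow_mul, pow_mul, neg_sq]
  ring

lemma hasDerivAt_C {κ : ℝ} (hκ : κ = -1 ∨ κ = 0 ∨ κ = 1) (x : ℝ) :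
    HasDerivAt (C κ) (-κ * S κ x) x := by
  rcases hκ with rfl | rfl | rfl
  · rw [C_neg_one, S_neg_one]
    simpa using Real.hasDerivAt_cosh x
  · rw [C_zero]
    simpa using hasDerivAt_const x (1 : ℝ)
  · rw [C_one, S_one]
    simpa using Real.hasDerivAt_cos x

lemma hasDerivAt_S {κ : ℝ} (hκ : κ = -1 ∨ κ = 0 ∨ κ = 1) (x : ℝ) :
    HasDerivAt (S κ) (C κ x) x := by
  rcases hκ with rfl | rfl | rfl
  · rw [C_neg_one, S_neg_one]
    exact Real.hasDerivAt_sinh x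
  · rw [C_zero, S_zero]
    exact hasDerivAt_id x
  · rw [C_one, S_one]
    exact Real.hasDerivAt_sin x

lemma contDiff_C {κ : ℝ} (hκ : κ = -1 ∨ κ = 0 ∨ κ = 1) : ContDiff ℝ 1 (C κ) := by
  rcases hκ with rfl | rfl | rfl
  · exact C_neg_one ▸ Real.contDiff_cosh
  · exact C_zero ▸ contDiff_const
  · exact C_one ▸ Real.contDiff_cos

lemma contDiff_S {κ : ℝ} (hκ : κ = -1 ∨ κ = 0 ∨ κ = 1) : ContDiff ℝ 1 (S κ) := by
  rcases hκ with rfl | rfl | rfl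
  · exact S_neg_one ▸ Real.contDiff_sinh
  · exact S_zero ▸ contDiff_id
  · exact S_one ▸ Real.contDiff_sin

/-! ### Linear maps that preserve the unit sphere and the Euclidean volume -/

/-- Matrices of determinant `±1` that map the unit sphere onto itself. -/
def volumeSymmetries {n : ℕ} (k : Fin n → ℝ) :
    Submonoid (Matrix (Fin (n + 1)) (Fin (n + 1)) ℝ) where
  carrier := {M | |M.det| = 1 ∧ (fun x => M.mulVec x) '' sphere k = sphere k}
  one_mem' := by simp
  mul_mem' := by
    rintro M N ⟨hM, hM'⟩ ⟨hN, hN'⟩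
    refine ⟨by rw [Matrix.det_mul, abs_mul, hM, hN, one_mul], ?_⟩
    simp only [← Matrix.mulVec_mulVec]
    rw [← image_image (fun x => M.mulVec x) (fun x => N.mulVec x), hN', hM']

section Symmetry

variable {n : ℕ} {k : Fin n → ℝ} {M : Matrix (Fin (n + 1)) (Fin (n + 1)) ℝ}

lemma isUnit_det_of_mem_volumeSymmetries (hM : M ∈ volumeSymmetries k) : IsUnit M.det :=
  isUnit_iff_ne_zero.2 fun h => by simpa [h] using hM.1

lemma mulVec_mem_sphere (hM : M ∈ volumeSymmetries k) {x : Fin (n + 1) → ℝ} (hx : x ∈ sphere k) :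
    M.mulVec x ∈ sphere k :=
  hM.2 ▸ mem_image_of_mem _ hx

lemma inv_mem_volumeSymmetries (hM : M ∈ volumeSymmetries k) : M⁻¹ ∈ volumeSymmetries k := by
  have hu := isUnit_det_of_mem_volumeSymmetries hM
  refine ⟨by rw [Matrix.det_nonsing_inv, Ring.inverse_eq_inv', abs_inv, hM.1, inv_one], ?_⟩
  conv_lhs => rw [← hM.2]
  rw [image_image]
  simp [Matrix.nonsing_inv_mul M hu]

lemma mulVec_injective (hM : M ∈ volumeSymmetries k) : Function.Injective fun x => M.mulVec x :=
  Matrix.mulVec_injective_iff_isUnit.2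
    ((Matrix.isUnit_iff_isUnit_det M).2 (isUnit_det_of_mem_volumeSymmetries hM))

lemma volume_cone_image (hM : M ∈ volumeSymmetries k) (F : Set (Fin (n + 1) → ℝ)) :
    volume (cone ((fun x => M.mulVec x) '' F)) = volume (cone F) := by
  have h : cone ((fun x => M.mulVec x) '' F) = Matrix.toLin' M '' cone F := by
    ext y
    constructor
    · rintro ⟨t, ht, _, ⟨x, hx, rfl⟩, rfl⟩
      exact ⟨t • x, smul_mem_cone hx ht, by simp⟩
    · rintro ⟨_, ⟨t, ht, x, hx, rfl⟩, rfl⟩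
      exact ⟨t, ht, _, ⟨x, hx, rfl⟩, by simp⟩
  rw [h, Measure.addHaar_image_linearMap, LinearMap.det_toLin', hM.1, ENNReal.ofReal_one, one_mul]

lemma sphereVolume_image (hM : M ∈ volumeSymmetries k) {F : Set (Fin (n + 1) → ℝ)}
    (hF : F ⊆ sphere k) : sphereVolume k ((fun x => M.mulVec x) '' F) = sphereVolume k F := by
  rw [sphereVolume_eq hF, sphereVolume_eq ((image_mono hF).trans hM.2.subset),
    volume_cone_image hM]

/-- The image of a patch. -/
noncomputable def Patch.map (P : Patch k) (hM : M ∈ volumeSymmetries k) : Patch k where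
  dom := P.dom
  param := fun u => M.mulVec (P.param u)
  piece := P.piece
  isOpen_dom := P.isOpen_dom
  contDiffOn := (LinearMap.toContinuousLinearMap (Matrix.mulVecLin M)).contDiff.comp_contDiffOn
    P.contDiffOn
  injOn := (mulVec_injective hM).comp_injOn P.injOn
  mapsTo := fun _ hu => mulVec_mem_sphere hM (P.mapsTo hu)
  measurableSet_piece := P.measurableSet_piece
  piece_subset := P.piece_subset

lemma Patch.carrier_map (P : Patch k) (hM : M ∈ volumeSymmetries k) :
    (P.map hM).carrier = (fun x => M.mulVec x) '' P.carrier :=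
  (image_image (fun x => M.mulVec x) P.param P.piece).symm

/-- Read off from the cones, so no transformation rule for `tangentVolume` is needed. -/
lemma Patch.vol_map (P : Patch k) (hM : M ∈ volumeSymmetries k) : (P.map hM).vol = P.vol := by
  rw [Patch.vol_eq_volume_cone, Patch.vol_eq_volume_cone, P.carrier_map hM, volume_cone_image hM]

/-- No lift of `F` with a measurable cone is assumed, so covers are transported patch by patch. The
reverse inequality is this one for `M⁻¹`. -/
lemma spaceVolume_projImage_le (hM : M ∈ volumeSymmetries k)
    (F : Set (ℙ ℝ (Fin (n + 1) → ℝ))) : spaceVolume k (projImage M F) ≤ spaceVolume k F := by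
  refine le_iInf₂ fun P hP => (iInf₂_le (fun i => (P i).map hM) ?_).trans
    (by simp only [Patch.vol_map, le_refl])
  rintro p ⟨q, hq, hpq⟩
  obtain ⟨x, hx, hxq⟩ := hP q hq
  obtain ⟨i, hi⟩ := mem_iUnion.1 hx
  refine ⟨M.mulVec x, mem_iUnion.2 ⟨i, ?_⟩, ?_⟩
  · rw [Patch.carrier_map]
    exact mem_image_of_mem _ hi
  · rw [hpq]
    exact Submodule.mem_map_of_mem (f := Matrix.toLin' M) hxq

lemma projImage_inv_projImage (hM : M ∈ volumeSymmetries k) (F : Set (ℙ ℝ (Fin (n + 1) → ℝ))) :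
    projImage M⁻¹ (projImage M F) = F := by
  have hu := isUnit_det_of_mem_volumeSymmetries hM
  have hcancel : ∀ V : Submodule ℝ (Fin (n + 1) → ℝ),
      (V.map (Matrix.toLin' M)).map (Matrix.toLin' M⁻¹) = V := fun V => by
    rw [← Submodule.map_comp, ← Matrix.toLin'_mul, Matrix.nonsing_inv_mul M hu, Matrix.toLin'_one,
      Submodule.map_id]
  ext p
  constructor
  · rintro ⟨q, ⟨r, hr, hqr⟩, hpq⟩
    rw [hqr, hcancel] at hpq
    rwa [Projectivization.submodule_injective hpq]
  · intro hp
    have hinj : Function.Injective (Matrix.toLin' M) := mulVec_injective hM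
    refine ⟨Projectivization.map (Matrix.toLin' M) hinj p, ⟨p, hp, ?_⟩, ?_⟩
    all_goals
      have : (Projectivization.map (Matrix.toLin' M) hinj p).submodule =
          p.submodule.map (Matrix.toLin' M) := by
        induction p using Projectivization.ind with
        | h v hv =>
          rw [Projectivization.map_mk, Projectivization.submodule_mk, Projectivization.submodule_mk,
            Submodule.map_span, image_singleton]
    · exact this
    · rw [this, hcancel]

lemma spaceVolume_projImage (hM : M ∈ volumeSymmetries k) (F : Set (ℙ ℝ (Fin (n + 1) → ℝ))) :
    spaceVolume k (projImage M F) = spaceVolume k F := by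
  refine (spaceVolume_projImage_le hM F).antisymm ?_
  conv_lhs => rw [← projImage_inv_projImage hM F]
  exact spaceVolume_projImage_le (inv_mem_volumeSymmetries hM) _

lemma projImage_space_subset (hM : M ∈ volumeSymmetries k) : projImage M (space k) ⊆ space k := by
  rintro p ⟨q, ⟨x, hxq, hx⟩, hpq⟩
  exact ⟨M.mulVec x, hpq ▸ Submodule.mem_map_of_mem (f := Matrix.toLin' M) hxq,
    mulVec_mem_sphere hM hx⟩

lemma projImage_mono {F G : Set (ℙ ℝ (Fin (n + 1) → ℝ))} (h : F ⊆ G) :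
    projImage M F ⊆ projImage M G :=
  fun _ ⟨q, hq, e⟩ => ⟨q, h hq, e⟩

lemma projImage_space (hM : M ∈ volumeSymmetries k) : projImage M (space k) = space k := by
  have hM' := inv_mem_volumeSymmetries hM
  refine (projImage_space_subset hM).antisymm ?_
  conv_lhs => rw [← projImage_inv_projImage hM' (space k),
    Matrix.nonsing_inv_nonsing_inv M (isUnit_det_of_mem_volumeSymmetries hM)]
  exact projImage_mono (projImage_space_subset hM')

end Symmetry

/-! ### Motions -/

section Motion

variable {n : ℕ} {k : Fin n → ℝ}

lemma mainRotation_mulVec (m : Fin n) (φ : ℝ) (x : Fin (n + 1) → ℝ) (i : Fin (n + 1)) :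
    (mainRotation k m φ).mulVec x i =
      if i = m.castSucc then C (k m) φ * x m.castSucc - k m * S (k m) φ * x m.succ
      else if i = m.succ then S (k m) φ * x m.castSucc + C (k m) φ * x m.succ
      else x i := by
  have hne : m.castSucc ≠ m.succ := Fin.castSucc_lt_succ.ne
  have hrow : ∀ j, mainRotation k m φ i j =
      if i = m.castSucc then (Pi.single m.castSucc (C (k m) φ) +
        Pi.single m.succ (-(k m) * S (k m) φ) : Fin (n + 1) → ℝ) j
      else if i = m.succ then (Pi.single m.castSucc (S (k m) φ) +
        Pi.single m.succ (C (k m) φ) : Fin (n + 1) → ℝ) j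
      else (Pi.single i 1 : Fin (n + 1) → ℝ) j := by
    intro j
    simp only [mainRotation, Matrix.of_apply, Pi.add_apply, Pi.single_apply]
    grind
  have hsum : ∀ a b : ℝ,
      ∑ j, (Pi.single m.castSucc a + Pi.single m.succ b : Fin (n + 1) → ℝ) j * x j =
        a * x m.castSucc + b * x m.succ := fun a b => by
    simp [add_mul, Finset.sum_add_distrib, Pi.single_apply, ite_mul]
  simp only [Matrix.mulVec, dotProduct, hrow]
  split_ifs with h1 h2
  · rw [hsum]; ring
  · rw [hsum]
  · simp [Pi.single_apply, ite_mul]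

lemma mainRotation_mul_neg (hk : IsSpecification k) (m : Fin n) (φ : ℝ) :
    mainRotation k m φ * mainRotation k m (-φ) = 1 := by
  have h := C_sq_add_S_sq (hk m) φ
  have hne : m.succ ≠ m.castSucc := Fin.castSucc_lt_succ.ne'
  refine Matrix.toLin'.injective (LinearMap.ext fun x => funext fun i => ?_)
  rw [Matrix.toLin'_mul_apply, Matrix.toLin'_one, LinearMap.id_apply, Matrix.toLin'_apply,
    Matrix.toLin'_apply]
  simp only [mainRotation_mulVec, C_neg, S_neg, if_true, if_neg hne]
  split_ifs with h1 h2
  · rw [h1]; linear_combination x m.castSucc * h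
  · rw [h2]; linear_combination x m.succ * h
  · rfl

/-- Conjugation by the reflection of one coordinate turns the rotation by `φ` into the rotation by
`-φ`, its inverse. So the determinant equals its own inverse. -/
lemma abs_det_mainRotation (hk : IsSpecification k) (m : Fin n) (φ : ℝ) :
    |(mainRotation k m φ).det| = 1 := by
  set d : Fin (n + 1) → ℝ := Function.update 1 m.succ (-1) with hd
  have hdd : (Matrix.diagonal d).det * (Matrix.diagonal d).det = 1 := by
    rw [Matrix.det_diagonal, ← Finset.prod_mul_distrib]
    refine Finset.prod_eq_one fun i _ => ?_
    by_cases h : i = m.succ <;> simp [hd, h]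
  have hconj : mainRotation k m (-φ) =
      Matrix.diagonal d * mainRotation k m φ * Matrix.diagonal d := by
    ext i j
    rw [Matrix.mul_diagonal, Matrix.diagonal_mul]
    simp only [mainRotation, Matrix.of_apply, C_neg, S_neg, hd, Function.update_apply,
      Pi.one_apply]
    split_ifs <;> grind
  have h1 := congrArg Matrix.det (mainRotation_mul_neg hk m φ)
  rw [hconj, Matrix.det_mul, Matrix.det_mul, Matrix.det_mul, Matrix.det_one] at h1
  rw [← sq_eq_sq₀ (abs_nonneg _) zero_le_one, sq_abs]
  linear_combination h1 - (mainRotation k m φ).det ^ 2 * hdd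

/-- In the rotated plane the form is `K k m.castSucc * (x² + k m * y²)` by `K_succ`, and `C² + k S²
= 1` makes the rotation preserve it. -/
lemma odot_mainRotation (hk : IsSpecification k) (m : Fin n) (φ : ℝ) (x : Fin (n + 1) → ℝ) :
    odot k ((mainRotation k m φ).mulVec x) ((mainRotation k m φ).mulVec x) = odot k x x := by
  have h := C_sq_add_S_sq (hk m) φ
  have hne : m.castSucc ≠ m.succ := Fin.castSucc_lt_succ.ne
  have hsplit : ∀ f : Fin (n + 1) → ℝ, ∑ i, f i =
      f m.castSucc + f m.succ + ∑ i ∈ Finset.univ \ {m.castSucc, m.succ}, f i := fun f => by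
    have h := Finset.sum_sdiff (Finset.subset_univ {m.castSucc, m.succ}) (f := f)
    rw [Finset.sum_pair hne] at h
    linarith
  rw [odot, odot, hsplit, hsplit]
  congr 1
  · simp only [mainRotation_mulVec, if_true, if_neg hne.symm, K_succ]
    linear_combination K k m.castSucc * (x m.castSucc ^ 2 + k m * x m.succ ^ 2) * h
  · refine Finset.sum_congr rfl fun i hi => ?_
    simp only [Finset.mem_sdiff, Finset.mem_univ, true_and, Finset.mem_insert,
      Finset.mem_singleton, not_or] at hi
    rw [mainRotation_mulVec, if_neg hi.1, if_neg hi.2]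

lemma image_sphere_eq {M N : Matrix (Fin (n + 1)) (Fin (n + 1)) ℝ} (hMN : M * N = 1)
    (hM : ∀ x, odot k (M.mulVec x) (M.mulVec x) = odot k x x) :
    (fun x => M.mulVec x) '' sphere k = sphere k := by
  refine Subset.antisymm ?_ fun x hx => ⟨N.mulVec x, ?_, ?_⟩
  · rintro _ ⟨x, hx, rfl⟩
    exact (hM x).trans hx
  · change odot k _ _ = 1
    rw [← hM, Matrix.mulVec_mulVec, hMN, Matrix.one_mulVec]
    exact hx
  · simp [Matrix.mulVec_mulVec, hMN]

lemma motions_le_volumeSymmetries (hk : IsSpecification k) :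
    motions k ≤ volumeSymmetries k := by
  refine sup_le (Submonoid.closure_le.2 ?_) (Submonoid.closure_le.2 ?_)
  · rintro _ ⟨m, φ, rfl⟩
    exact ⟨abs_det_mainRotation hk m φ,
      image_sphere_eq (mainRotation_mul_neg hk m φ) (odot_mainRotation hk m φ)⟩
  · rintro _ ⟨d, hd, rfl⟩
    have hdd : ∀ i, d i * d i = 1 := fun i => by rcases hd i with h | h <;> simp [h]
    refine ⟨?_, image_sphere_eq (N := Matrix.diagonal d) ?_ fun x => ?_⟩
    · rw [Matrix.det_diagonal, Finset.abs_prod]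
      exact Finset.prod_eq_one fun i _ => by rcases hd i with h | h <;> simp [h]
    · simp [Matrix.diagonal_mul_diagonal, hdd]
    · refine Finset.sum_congr rfl fun i _ => ?_
      rw [Matrix.mulVec_diagonal]
      linear_combination K k i * x i ^ 2 * hdd i

end Motion

/-! ### Sectors of the one-dimensional space -/

section Arc

variable {κ α β : ℝ}

/-- The point of the one-dimensional unit sphere with parameter `φ`. -/
noncomputable def circlePoint (κ φ : ℝ) : Fin (1 + 1) → ℝ := ![C κ φ, S κ φ]

lemma circlePoint_mem_sphere (hκ : κ = -1 ∨ κ = 0 ∨ κ = 1) (φ : ℝ) :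
    circlePoint κ φ ∈ sphere fun _ : Fin 1 => κ := by
  have hK : K (fun _ : Fin 1 => κ) 1 = κ := by
    have := K_succ (fun _ : Fin 1 => κ) 0
    simpa [K_zero] using this
  have h := C_sq_add_S_sq hκ φ
  change odot _ _ _ = 1
  rw [odot, Fin.sum_univ_two, hK, K_zero]
  simp only [circlePoint, Matrix.cons_val_zero, Matrix.cons_val_one]
  linear_combination h

/-- For `κ = -1` and `κ = 0` the function `S` alone is injective. For `κ = 1` two parameters of the
same point differ by a multiple of `2π`; the interval is open because the endpoints of a full turn
coincide. -/
lemma circlePoint_injOn (hκ : κ = -1 ∨ κ = 0 ∨ κ = 1)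
    (hβ : κ = 1 → β - α ≤ 2 * Real.pi) : InjOn (circlePoint κ) (Ioo α β) := by
  intro a ha b hb h
  have hC : C κ a = C κ b := congrFun h 0
  have hS : S κ a = S κ b := congrFun h 1
  rcases hκ with rfl | rfl | rfl
  · rw [S_neg_one] at hS
    exact Real.sinh_injective hS
  · rwa [S_zero] at hS
  · rw [C_one] at hC
    rw [S_one] at hS
    obtain ⟨m, hm⟩ := Real.Angle.angle_eq_iff_two_pi_dvd_sub.1 (Real.Angle.cos_sin_inj hC hS)
    have hπ := Real.pi_pos
    have h1 : |a - b| < 2 * Real.pi :=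
      (abs_lt.2 ⟨by linarith [ha.1, hb.2], by linarith [ha.2, hb.1]⟩).trans_le (hβ rfl)
    rw [hm, abs_mul, abs_of_pos (by positivity : 0 < 2 * Real.pi)] at h1
    have h2 : |(m : ℝ)| < 1 := by nlinarith
    have h3 : m = 0 := Int.abs_lt_one_iff.1 (by exact_mod_cast h2)
    rw [h3, Int.cast_zero, mul_zero] at hm
    linarith

lemma contDiff_circlePoint (hκ : κ = -1 ∨ κ = 0 ∨ κ = 1) : ContDiff ℝ 1 (circlePoint κ) := by
  refine contDiff_pi.2 fun i => ?_
  fin_cases i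
  · exact contDiff_C hκ
  · exact contDiff_S hκ

lemma hasDerivAt_circlePoint (hκ : κ = -1 ∨ κ = 0 ∨ κ = 1) (φ : ℝ) :
    HasDerivAt (circlePoint κ) ![-κ * S κ φ, C κ φ] φ := by
  refine hasDerivAt_pi.2 fun i => ?_
  fin_cases i
  · exact hasDerivAt_C hκ φ
  · exact hasDerivAt_S hκ φ

/-- The open arc as a patch. -/
noncomputable def arcPatch (hκ : κ = -1 ∨ κ = 0 ∨ κ = 1) (hβ : κ = 1 → β - α ≤ 2 * Real.pi) :
    Patch fun _ : Fin 1 => κ where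
  dom := pi univ fun _ => Ioo α β
  param := fun u => circlePoint κ (u 0)
  piece := pi univ fun _ => Ioo α β
  isOpen_dom := isOpen_set_pi finite_univ fun _ _ => isOpen_Ioo
  contDiffOn := ((contDiff_circlePoint hκ).comp (contDiff_apply ℝ ℝ 0)).contDiffOn
  injOn := fun u hu w hw h => funext fun i => by
    rw [Subsingleton.elim i 0]
    exact circlePoint_injOn hκ hβ (hu 0 trivial) (hw 0 trivial) h
  mapsTo := fun u _ => circlePoint_mem_sphere hκ (u 0)
  measurableSet_piece := MeasurableSet.univ_pi fun _ => measurableSet_Ioo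
  piece_subset := Subset.rfl

lemma carrier_arcPatch (hκ : κ = -1 ∨ κ = 0 ∨ κ = 1) (hβ : κ = 1 → β - α ≤ 2 * Real.pi) :
    (arcPatch hκ hβ).carrier = circlePoint κ '' Ioo α β := by
  ext x
  constructor
  · rintro ⟨u, hu, rfl⟩
    exact ⟨u 0, hu 0 trivial, rfl⟩
  · rintro ⟨φ, hφ, rfl⟩
    exact ⟨fun _ => φ, fun _ _ => hφ, rfl⟩

lemma vol_arcPatch (hκ : κ = -1 ∨ κ = 0 ∨ κ = 1) (hβ : κ = 1 → β - α ≤ 2 * Real.pi) :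
    (arcPatch hκ hβ).vol = ENNReal.ofReal (β - α) := by
  -- The determinant with rows `(C, S)` and `(-κ S, C)` is `C² + κ S²`.
  have hJ : ∀ u, (arcPatch hκ hβ).jacobian u = 1 := by
    intro u
    have hd := HasFDerivAt.comp (g := circlePoint κ) (f := fun u : Fin 1 → ℝ => u 0) u
      (hasDerivAt_circlePoint hκ (u 0)).hasFDerivAt
        (hasFDerivAt_apply (𝕜 := ℝ) (F' := fun _ : Fin 1 => ℝ) 0 u)
    have hv : fderiv ℝ (arcPatch hκ hβ).param u (Pi.single 0 1) =
        ![-κ * S κ (u 0), C κ (u 0)] := by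
      refine (congrArg (fun L => L (Pi.single 0 1)) hd.fderiv).trans ?_
      simp
    have hp : (arcPatch hκ hβ).param u = ![C κ (u 0), S κ (u 0)] := rfl
    rw [Patch.jacobian, frameDet, Matrix.det_fin_two, Matrix.of_apply, Matrix.of_apply,
      Matrix.of_apply, Matrix.of_apply, ← Fin.succ_zero_eq_one', Fin.cons_zero, Fin.cons_succ, hv,
      hp]
    have h := C_sq_add_S_sq hκ (u 0)
    simp
    linear_combination h
  rw [Patch.vol_eq]
  simp only [hJ, abs_one, ENNReal.ofReal_one, lintegral_const, one_mul]
  rw [Measure.restrict_apply MeasurableSet.univ, univ_inter]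
  change volume (pi univ fun _ : Fin 1 => Ioo α β) = _
  rw [Real.volume_pi_Ioo]
  simp

lemma volume_cone_singleton (x : Fin (1 + 1) → ℝ) : volume (cone {x}) = 0 := by
  refine measure_mono_null (t := (Submodule.span ℝ {x} : Set (Fin (1 + 1) → ℝ))) ?_
    (Measure.addHaar_submodule _ _ fun h => ?_)
  · rintro _ ⟨t, -, _, rfl, rfl⟩
    exact Submodule.smul_mem _ t (Submodule.mem_span_singleton_self _)
  · have h1 := finrank_span_le_card (R := ℝ) ({x} : Set (Fin (1 + 1) → ℝ))
    rw [h, finrank_top] at h1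
    simp at h1

/-- The closed arc exceeds the open one by its endpoints, whose cones are segments and hence null.
The factor `1 / 2` is `1 / (n + 1)` for `n = 1`. -/
lemma volume_cone_arc (hκ : κ = -1 ∨ κ = 0 ∨ κ = 1) (hβ : κ = 1 → β - α ≤ 2 * Real.pi) :
    volume (cone (arc κ α β)) = ENNReal.ofReal ((β - α) / 2) := by
  have h : volume (cone (arc κ α β)) = volume (cone (arcPatch hκ hβ).carrier) := by
    rw [carrier_arcPatch]
    refine le_antisymm ?_ (measure_mono (cone_mono (image_mono Ioo_subset_Icc_self)))
    have hsub : cone (arc κ α β) ⊆ cone (circlePoint κ '' Ioo α β) ∪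
        (cone {circlePoint κ α} ∪ cone {circlePoint κ β}) := by
      rintro _ ⟨t, ht, _, ⟨φ, hφ, rfl⟩, rfl⟩
      rcases eq_or_lt_of_le hφ.1 with rfl | h1
      · exact Or.inr (Or.inl (smul_mem_cone (mem_singleton _) ht))
      rcases eq_or_lt_of_le hφ.2 with rfl | h2
      · exact Or.inr (Or.inr (smul_mem_cone (mem_singleton _) ht))
      exact Or.inl (smul_mem_cone (mem_image_of_mem (circlePoint κ) (mem_Ioo.2 ⟨h1, h2⟩)) ht)
    refine (measure_mono hsub).trans ((measure_union_le _ _).trans ?_)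
    rw [measure_union_null (volume_cone_singleton _) (volume_cone_singleton _), add_zero]
  rw [h, Patch.volume_cone, vol_arcPatch, div_eq_inv_mul, ENNReal.ofReal_mul (by norm_num),
    ENNReal.ofReal_inv_of_pos two_pos]
  norm_num

lemma sphereVolume_arc (hκ : κ = -1 ∨ κ = 0 ∨ κ = 1) (hβ : κ = 1 → β - α ≤ 2 * Real.pi) :
    sphereVolume (fun _ : Fin 1 => κ) (arc κ α β) = ENNReal.ofReal (β - α) := by
  have hs : arc κ α β ⊆ sphere fun _ : Fin 1 => κ := by
    rintro _ ⟨φ, -, rfl⟩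
    exact circlePoint_mem_sphere hκ φ
  have h2 : ((1 : ℕ) : ℝ≥0∞) + 1 = ENNReal.ofReal 2 := by norm_num
  rw [sphereVolume_eq hs, volume_cone_arc hκ hβ, h2, ← ENNReal.ofReal_mul zero_le_two]
  congr 1
  ring

end Arc

end GeomSpace

theorem mainTheorem8 :
    -- sectors of the one-dimensional space: the area, and twice the area is the length of the arc
    (∀ κ α β : ℝ, (κ = -1 ∨ κ = 0 ∨ κ = 1) → α ≤ β → (κ = 1 → β - α ≤ 2 * Real.pi) →
      volume (GeomSpace.cone (GeomSpace.arc κ α β)) = ENNReal.ofReal ((β - α) / 2) ∧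
      GeomSpace.sphereVolume (fun _ : Fin 1 => κ) (GeomSpace.arc κ α β)
        = ENNReal.ofReal (β - α)) ∧
    ∀ (n : ℕ) (k : Fin n → ℝ), GeomSpace.IsSpecification k →
      -- the volume of a figure on the unit sphere is `n + 1` times the volume of its cone
      (∀ F : Set (Fin (n + 1) → ℝ), F ⊆ GeomSpace.sphere k →
        GeomSpace.sphereVolume k F = ((n : ℝ≥0∞) + 1) * volume (GeomSpace.cone F)) ∧
      -- the same for a figure in projective space, given by normalized coordinate vectors
      (∀ (F : Set (ℙ ℝ (Fin (n + 1) → ℝ))) (G : Set (Fin (n + 1) → ℝ)),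
        F ⊆ GeomSpace.space k → GeomSpace.IsLift k G F →
        NullMeasurableSet (GeomSpace.cone G) volume →
        GeomSpace.spaceVolume k F = ((n : ℝ≥0∞) + 1) * volume (GeomSpace.cone G)) ∧
      -- motions preserve the space and the volumes
      (∀ M ∈ GeomSpace.motions k,
        |M.det| = 1 ∧
        (fun x => M.mulVec x) '' GeomSpace.sphere k = GeomSpace.sphere k ∧
        GeomSpace.projImage M (GeomSpace.space k) = GeomSpace.space k ∧
        (∀ F : Set (Fin (n + 1) → ℝ), F ⊆ GeomSpace.sphere k →
          volume (GeomSpace.cone ((fun x => M.mulVec x) '' F)) = volume (GeomSpace.cone F) ∧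
          GeomSpace.sphereVolume k ((fun x => M.mulVec x) '' F) = GeomSpace.sphereVolume k F) ∧
        (∀ F : Set (ℙ ℝ (Fin (n + 1) → ℝ)), F ⊆ GeomSpace.space k →
          GeomSpace.spaceVolume k (GeomSpace.projImage M F) = GeomSpace.spaceVolume k F)) := by
  refine ⟨fun κ α β hκ _ hβ => ⟨GeomSpace.volume_cone_arc hκ hβ, GeomSpace.sphereVolume_arc hκ hβ⟩,
    fun n k hk => ⟨fun F hF => GeomSpace.sphereVolume_eq hF,
      fun F G _ hG hm => GeomSpace.spaceVolume_eq hG hm, fun M hM => ?_⟩⟩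
  have hM' := GeomSpace.motions_le_volumeSymmetries hk hM
  exact ⟨hM'.1, hM'.2, GeomSpace.projImage_space hM',
    fun F hF => ⟨GeomSpace.volume_cone_image hM' F, GeomSpace.sphereVolume_image hM' hF⟩,
    fun F _ => GeomSpace.spaceVolume_projImage hM' F⟩
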